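/- Let $X$ be a reflexive real Banach space whose dual $X^*$ is separable, let $[t_0,T]\subset\mathbb R$, and let $(\Omega,\mathcal F,(\mathcal F_t)_{t\in[t_0,T]},\mathbb P)$ be a filtered probability space satisfying the usual conditions (each $\mathcal F_t$ contains all $\mathbb P$-null sets, in particular $\mathcal F$ is $\mathbb P$-complete, and the filtration is right-continuous). A map $F$ from a measurable space $(S,\mathcal S)$ to the subsets of $X$ is called $\mathcal S$-measurable if $\{s\in S: F(s)\cap O\neq\emptyset\}\in\mathcal S$ for every open $O\subseteq X$; a random closed set is an $\mathcal F$-measurable map from $\Omega$ to the non-empty closed subsets of $X$. Let $\mathcal P$ be the predictable $\sigma$-algebra on $\Omega\times[t_0,T]$, i.e. the $\sigma$-algebra generated by all processes $H:\Omega\times[t_0,T]\to\{\text{non-empty closed subsets of }X\}$ that are adapted ($H(\cdot,t)$ is $\mathcal F_t$-measurable for every $t$) and whose trajectories are almost surely left-continuous with respect to the Hausdorff distance. Let $G$ map $\Omega\times[t_0,T]$ to the closed subsets of $X$ and suppose that 1. $0\in G(\omega,t)$ for all $(\omega,t)$; 2. $G(\omega,t)$ is convex for all $(\omega,t)$; 3.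 there is a non-empty closed bounded set $K\subseteq X$ with $G(\omega,t)\subseteq K$ for all $(\omega,t)$; 4. $G$ is $\mathcal P$-measurable. For $a\le b$ in $[t_0,T]$ let $$\int_a^b G(\omega,\tau)\,d\tau=\Big\{\int_a^b g(\tau)\,d\tau:\ g\in L^1([t_0,T];X),\ g(\tau)\in G(\omega,\tau)\text{ for a.e. }\tau\in[t_0,T]\Big\}$$ be the Aumann integral with respect to Lebesgue measure (the integrals on the right being Bochner integrals), and for $b<a$ put $\int_a^b G(\omega,\tau)\,d\tau=-\int_b^a G(\omega,\tau)\,d\tau$. Then, for all $a,b\in[t_0,T]$, the set $\int_a^b G(\omega,\tau)\,d\tau$ is non-empty for every $\omega\in\Omega$ and the set-valued map $\omega\mapsto G_{a,b}(\omega)=\int_a^b G(\omega,\tau)\,d\tau$ is $\mathcal F$-measurable. Moreover $G_{a,b}$ is a random closed set with bounded convex values: for every $\omega$, $G_{a,b}(\omega)$ is non-empty, closed, bounded and convex. -/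

import Mathlib

open MeasureTheory Set Filter Topology
open scoped Pointwise ENNReal

noncomputable section

/-- A real normed space is reflexive if the canonical map into its bidual is onto. -/
def IsReflexiveSpace (X : Type*) [NormedAddCommGroup X] [NormedSpace ℝ X] : Prop :=
  Function.Surjective (NormedSpace.inclusionInDoubleDual ℝ X)

/-- A set-valued map `F : S → Set X` is measurable with respect to the σ-algebra `m` on `S` if
`{s | F s ∩ O ≠ ∅}` belongs to `m` for every open `O ⊆ X`. -/
def IsMeasurableSetMap {S X : Type*} [TopologicalSpace X] (m : MeasurableSpace S)
    (F : S → Set X) : Prop :=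
  ∀ O : Set X, IsOpen O → MeasurableSet[m] {s | (F s ∩ O).Nonempty}

/-- A random closed set: a measurable map whose values are non-empty closed sets. -/
structure IsRandomClosedSet {Ω X : Type*} [TopologicalSpace X] (m : MeasurableSpace Ω)
    (F : Ω → Set X) : Prop where
  nonempty : ∀ ω, (F ω).Nonempty
  isClosed : ∀ ω, IsClosed (F ω)
  measurable : IsMeasurableSetMap m F

/-- The usual conditions on a filtration: each of its σ-algebras contains every `P`-null set
(`P s` is the outer measure when `s` is not known to be measurable, so the underlying space is
complete as well), and it is right-continuous. -/
structure HasUsualConditions {Ω ι : Type*} [PartialOrder ι] {m : MeasurableSpace Ω}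
    (𝓕 : Filtration ι m) (P : Measure Ω) : Prop where
  null_mem : ∀ (t : ι) (s : Set Ω), P s = 0 → MeasurableSet[𝓕 t] s
  rightContinuous : 𝓕.IsRightContinuous

/-- `H` is an adapted process with non-empty closed values in `X` which almost surely has
trajectories that are left-continuous for the (extended) Hausdorff distance. -/
structure IsLeftContinuousAdapted {Ω ι : Type*} (X : Type*) [NormedAddCommGroup X]
    [PartialOrder ι] [TopologicalSpace ι] {m : MeasurableSpace Ω}
    (𝓕 : Filtration ι m) (P : Measure Ω) (H : Ω → ι → Set X) : Prop where
  adapted : ∀ t, IsRandomClosedSet (𝓕 t) (fun ω => H ω t)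
  leftContinuous : ∀ᵐ ω ∂P, ∀ u : ι,
    Tendsto (fun t => Metric.hausdorffEDist (H ω t) (H ω u)) (𝓝[<] u) (𝓝 0)

/-- The predictable σ-algebra on `Ω × ι`: the smallest σ-algebra for which every left-continuous
adapted process with non-empty closed values in `X` is measurable. -/
@[reducible]
def predictableSigmaAlgebra {Ω ι : Type*} (X : Type*) [NormedAddCommGroup X]
    [PartialOrder ι] [TopologicalSpace ι] {m : MeasurableSpace Ω}
    (𝓕 : Filtration ι m) (P : Measure Ω) : MeasurableSpace (Ω × ι) :=
  MeasurableSpace.generateFrom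
    {A | ∃ (H : Ω → ι → Set X) (O : Set X), IsLeftContinuousAdapted X 𝓕 P H ∧ IsOpen O ∧
      A = {p : Ω × ι | (H p.1 p.2 ∩ O).Nonempty}}

/-- The Aumann integral `∫_A F dμ`: all Bochner integrals over `A` of the `μ`-integrable
selections of `F`. -/
def aumannIntegral {S X : Type*} [NormedAddCommGroup X] [NormedSpace ℝ X] [MeasurableSpace S]
    (μ : Measure S) (F : S → Set X) (A : Set S) : Set X :=
  {y | ∃ x : S → X, Integrable x μ ∧ (∀ᵐ s ∂μ, x s ∈ F s) ∧ ∫ s in A, x s ∂μ = y}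

/-- Lebesgue measure on the interval `[t₀, T]`. -/
def lebesgueIcc (t₀ T : ℝ) : Measure (Icc t₀ T) :=
  Measure.comap Subtype.val volume

open scoped Classical in
/-- The Aumann integral `∫_a^b F(τ) dτ` with respect to Lebesgue measure on `[t₀, T]`, with the
usual orientation `∫_a^b = -∫_b^a` when `b < a`. -/
def aumannIntervalIntegral {X : Type*} [NormedAddCommGroup X] [NormedSpace ℝ X] {t₀ T : ℝ}
    (F : Icc t₀ T → Set X) (a b : Icc t₀ T) : Set X :=
  if a ≤ b then aumannIntegral (lebesgueIcc t₀ T) F (Icc a b)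
  else -aumannIntegral (lebesgueIcc t₀ T) F (Icc b a)

end

/-!
Closedness. A separable space `X` embeds into `ℓ²` by an injective operator `J`. If `y` is a limit
of integrals of selections, the `L²`-selections whose integral is within `1 / (n + 1)` of `y` form a
decreasing sequence of convex sets; elements of nearly minimal norm of their images under `J` are
Cauchy by the parallelogram law, hence converge almost everywhere along a subsequence. By
reflexivity the corresponding bounded values in `X` then converge weakly, the weak limit is again a
selection, and its integral is `y`.

Measurability. The support function of the Aumann integral is the integral of the support
functions, by measurable selection of near-maximizers. The distance from `x` to a bounded convex set
`C` is the supremum of `f x - sup_C f` over the dual unit ball, which for separable `X*` may be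
taken over a countable set, so an integral of jointly measurable support functions gives a
measurable distance function. A left-continuous process is jointly measurable, so a predictable one
is jointly measurable after a change on a `P`-null set of `ω`, which completeness of `P` absorbs.
-/

open TopologicalSpace

section SeparableDual

variable {X : Type*} [NormedAddCommGroup X] [NormedSpace ℝ X]

theorem exists_norm_le_one_half_norm_le_apply (f : StrongDual ℝ X) :
    ∃ x : X, ‖x‖ ≤ 1 ∧ ‖f‖ / 2 ≤ f x := by
  rcases eq_or_ne f 0 with rfl | hf
  · exact ⟨0, by simp, by simp⟩
  obtain ⟨x, hx, hfx⟩ := f.exists_lt_apply_of_lt_opNorm (half_lt_self (norm_pos_iff.2 hf))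
  rcases le_total 0 (f x) with hnonneg | hnonpos
  · exact ⟨x, hx.le, by simpa [Real.norm_of_nonneg hnonneg] using hfx.le⟩
  · exact ⟨-x, by simpa using hx.le, by simpa [Real.norm_of_nonpos hnonpos] using hfx.le⟩

theorem dense_span_of_forall_dual_eq_zero {s : Set X}
    (hs : ∀ f : StrongDual ℝ X, (∀ x ∈ s, f x = 0) → f = 0) :
    Dense (Submodule.span ℝ s : Set X) := by
  refine dense_iff_closure_eq.2 (eq_univ_of_forall fun z => ?_)
  by_contra hz
  obtain ⟨f, u, hfu, huz⟩ := geometric_hahn_banach_closed_point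
    (Submodule.span ℝ s).convex.closure isClosed_closure hz
  have hf : f = 0 := by
    refine hs f fun x hx => ?_
    by_contra hfx
    have hmem : (u / f x) • x ∈ Submodule.span ℝ s :=
      Submodule.smul_mem _ _ (Submodule.subset_span hx)
    simpa [hfx] using hfu _ (subset_closure hmem)
  have hu : 0 < u := by simpa [hf] using hfu 0 (subset_closure (Submodule.zero_mem _))
  have : u < 0 := by simpa [hf] using huz
  exact lt_asymm hu this

theorem separableSpace_of_separableSpace_dual [SeparableSpace (StrongDual ℝ X)] :
    SeparableSpace X := by
  let f := denseSeq (StrongDual ℝ X)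
  choose x hx hfx using fun n => exists_norm_le_one_half_norm_le_apply (f n)
  have hdense : Dense (Submodule.span ℝ (range x) : Set X) := by
    refine dense_span_of_forall_dual_eq_zero fun φ hφ => ?_
    by_contra hne
    obtain ⟨n, hn⟩ : ∃ n, dist φ (f n) < ‖φ‖ / 4 :=
      (denseRange_denseSeq (StrongDual ℝ X)).exists_dist_lt φ (by positivity)
    rw [dist_eq_norm'] at hn
    have hhalf : ‖f n‖ / 2 ≤ ‖f n - φ‖ := calc
      ‖f n‖ / 2 ≤ (f n - φ) (x n) := by simpa [hφ (x n) (mem_range_self n)] using hfx n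
      _ ≤ ‖f n - φ‖ := (le_abs_self _).trans ((f n - φ).unit_le_opNorm _ (hx n))
    linarith [norm_nonneg φ, norm_le_norm_add_norm_sub (f n) φ]
  have hsep := (countable_range x).isSeparable.span (R := ℝ) |>.closure
  rw [hdense.closure_eq] at hsep
  exact isSeparable_univ_iff.1 hsep

end SeparableDual

section HilbertEmbedding

variable {X : Type*} [NormedAddCommGroup X] [NormedSpace ℝ X]

theorem exists_seq_dual_separating [SeparableSpace X] :
    ∃ f : ℕ → StrongDual ℝ X, (∀ n, ‖f n‖ ≤ 1) ∧ ∀ x, (∀ n, f n x = 0) → x = 0 := by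
  choose f hf hfx using fun n => exists_dual_vector'' ℝ (denseSeq X n)
  refine ⟨f, hf, fun x hx => norm_le_zero_iff.1 (le_of_forall_pos_lt_add fun ε hε => ?_)⟩
  obtain ⟨n, hn⟩ := (denseRange_denseSeq X).exists_dist_lt x (half_pos hε)
  rw [dist_eq_norm] at hn
  have hdn : ‖denseSeq X n‖ ≤ ‖x - denseSeq X n‖ := calc
    ‖denseSeq X n‖ = f n (denseSeq X n - x) := by rw [map_sub, hx n, sub_zero, hfx n]; rfl
    _ ≤ ‖f n‖ * ‖denseSeq X n - x‖ := (le_abs_self _).trans ((f n).le_opNorm _)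
    _ ≤ ‖x - denseSeq X n‖ := by
      rw [norm_sub_rev]
      exact mul_le_of_le_one_left (norm_nonneg _) (hf n)
  linarith [norm_le_norm_add_norm_sub' x (denseSeq X n)]

theorem exists_injective_continuousLinearMap_ell2 [SeparableSpace X] :
    ∃ J : X →L[ℝ] lp (fun _ : ℕ => ℝ) 2, Function.Injective J := by
  obtain ⟨f, hf, hsep⟩ := exists_seq_dual_separating (X := X)
  let e : ℕ → lp (fun _ : ℕ => ℝ) 2 := fun n => lp.single 2 n 1
  let T : ℕ → X →L[ℝ] lp (fun _ : ℕ => ℝ) 2 := fun n => (f n).smulRight ((1 / 2 : ℝ) ^ n • e n)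
  have hT : Summable T := by
    refine .of_norm_bounded summable_geometric_two fun n => ?_
    simpa [T, e, norm_smul, lp.norm_single] using hf n
  refine ⟨∑' n, T n, (injective_iff_map_eq_zero _).2 fun x hx => hsep x fun n => ?_⟩
  have hsum : HasSum (fun k => inner ℝ (e n) (T k x)) 0 := by
    simpa [hx] using
      ((innerSL ℝ (e n)).comp (ContinuousLinearMap.apply ℝ _ x)).hasSum hT.hasSum
  have hsingle : inner ℝ (e n) (T n x) = 0 :=
    (hasSum_single n fun k hk => by
      simp [T, e, inner_smul_right, lp.inner_single_left, hk.symm]).unique hsum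
  simpa [T, e, inner_smul_right, lp.inner_single_left] using hsingle

end HilbertEmbedding

section WeakLimits

theorem norm_sub_sq_le_of_mem_convex {E : Type*} [NormedAddCommGroup E] [InnerProductSpace ℝ E]
    {D : Set E} (hD : Convex ℝ D) {δ : ℝ} (hδ : ∀ v ∈ D, δ ≤ ‖v‖ ^ 2) {v w : E} (hv : v ∈ D)
    (hw : w ∈ D) : ‖v - w‖ ^ 2 ≤ 2 * (‖v‖ ^ 2 - δ) + 2 * (‖w‖ ^ 2 - δ) := by
  have hmid : δ ≤ ‖(1 / 2 : ℝ) • (v + w)‖ ^ 2 := by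
    rw [smul_add]
    exact hδ _ (hD hv hw (by norm_num) (by norm_num) (by norm_num))
  rw [norm_smul, mul_pow, show ‖(1 / 2 : ℝ)‖ ^ 2 = 1 / 4 by norm_num] at hmid
  linarith [parallelogram_law_with_norm ℝ v w]

theorem exists_cauchySeq_mem_of_antitone_convex {E : Type*} [NormedAddCommGroup E]
    [InnerProductSpace ℝ E] {D : ℕ → Set E} (hD : Antitone D) (hne : ∀ n, (D n).Nonempty)
    (hconv : ∀ n, Convex ℝ (D n)) {R : ℝ} (hR : ∀ v ∈ D 0, ‖v‖ ≤ R) :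
    ∃ w : ℕ → E, (∀ n, w n ∈ D n) ∧ CauchySeq w := by
  let δ : ℕ → ℝ := fun n => sInf ((‖·‖ ^ 2) '' D n)
  have hbelow : ∀ n, BddBelow ((fun v : E => ‖v‖ ^ 2) '' D n) := fun n =>
    ⟨0, forall_mem_image.2 fun v _ => sq_nonneg ‖v‖⟩
  have hδ : ∀ n, ∀ v ∈ D n, δ n ≤ ‖v‖ ^ 2 := fun n v hv => csInf_le (hbelow n) ⟨v, hv, rfl⟩
  have hmono : Monotone δ := fun i j hij =>
    csInf_le_csInf (hbelow i) ((hne j).image _) (image_mono (hD hij))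
  have habove : BddAbove (range δ) := by
    refine ⟨R ^ 2, forall_mem_range.2 fun n => ?_⟩
    obtain ⟨v, hv⟩ := hne n
    exact (hδ n v hv).trans (by gcongr; exact hR v (hD n.zero_le hv))
  have hlt : ∀ n : ℕ, ∃ v ∈ D n, ‖v‖ ^ 2 < δ n + 1 / ((n : ℝ) + 1) := fun n => by
    simpa using exists_lt_of_csInf_lt ((hne n).image _)
      (lt_add_of_pos_right (δ n) (Nat.one_div_pos_of_nat (n := n)))
  choose w hwD hw using hlt
  let L := ⨆ n, δ n
  have hdist : ∀ m n N : ℕ, N ≤ m → N ≤ n →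
      ‖w m - w n‖ ^ 2 ≤ 4 * (L - δ N + 1 / ((N : ℝ) + 1)) := fun m n N hm hn => by
    have hwN : ∀ k, N ≤ k → ‖w k‖ ^ 2 - δ N ≤ L - δ N + 1 / ((N : ℝ) + 1) := fun k hk => by
      linarith [hw k, le_ciSup habove k, Nat.one_div_le_one_div (α := ℝ) hk]
    linarith [hwN m hm, hwN n hn,
      norm_sub_sq_le_of_mem_convex (hconv N) (hδ N) (hD hm (hwD m)) (hD hn (hwD n))]
  have hzero : Tendsto (fun N : ℕ => √(4 * (L - δ N + 1 / ((N : ℝ) + 1)))) atTop (𝓝 0) := by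
    simpa [L] using (((tendsto_atTop_ciSup hmono habove).const_sub L).add
      tendsto_one_div_add_atTop_nhds_zero_nat).const_mul 4 |>.sqrt
  refine ⟨w, hwD, cauchySeq_of_le_tendsto_0 _ (fun m n N hm hn => ?_) hzero⟩
  rw [dist_eq_norm]
  exact Real.le_sqrt_of_sq_le (hdist m n N hm hn)

variable {X : Type*} [NormedAddCommGroup X] [NormedSpace ℝ X]

theorem IsReflexiveSpace.isCompact_closure_toWeakSpace (hX : IsReflexiveSpace X) {B : Set X}
    (hB : Bornology.IsBounded B) : IsCompact (closure (toWeakSpace ℝ X '' B)) := by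
  refine NormedSpace.isCompact_closure_of_isBounded ℝ X _
    (by rwa [preimage_image_eq _ (toWeakSpace ℝ X).injective]) fun Λ _ => ?_
  obtain ⟨x, hx⟩ := hX Λ
  exact ⟨toWeakSpace ℝ X x, hx⟩

theorem IsReflexiveSpace.exists_tendsto_toWeakSpace (hX : IsReflexiveSpace X) {E : Type*}
    [NormedAddCommGroup E] [NormedSpace ℝ E] {J : X →L[ℝ] E} (hJ : Function.Injective J)
    {ι : Type*} {l : Filter ι} [l.NeBot] {x : ι → X} (hx : Bornology.IsBounded (range x)) {v : E}
    (hv : Tendsto (fun i => J (x i)) l (𝓝 v)) :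
    ∃ z, J z = v ∧ Tendsto (fun i => toWeakSpace ℝ X (x i)) l (𝓝 (toWeakSpace ℝ X z)) := by
  have hcompact := hX.isCompact_closure_toWeakSpace hx
  have hmem : ∀ i, toWeakSpace ℝ X (x i) ∈ closure (toWeakSpace ℝ X '' range x) := fun i =>
    subset_closure (mem_image_of_mem _ (mem_range_self i))
  have hvweak : Tendsto (fun i => WeakSpace.map J (toWeakSpace ℝ X (x i))) l
      (𝓝 (toWeakSpace ℝ E v)) := ((toWeakSpaceCLM ℝ E).continuous.tendsto v).comp hv
  have hclusterPt : ∀ z : X, MapClusterPt (toWeakSpace ℝ X z) l (fun i => toWeakSpace ℝ X (x i)) →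
      J z = v := fun z hz => by
    have : (𝓝 (toWeakSpace ℝ E (J z)) ⊓ 𝓝 (toWeakSpace ℝ E v)).NeBot :=
      (hz.continuousAt_comp (WeakSpace.map J).continuous.continuousAt).clusterPt.mono hvweak
    exact (toWeakSpace ℝ E).injective (eq_of_nhds_neBot this)
  obtain ⟨z, -, hz⟩ := hcompact.exists_mapClusterPt
    (tendsto_principal.2 (.of_forall hmem : ∀ᶠ i in l, _))
  refine ⟨(toWeakSpace ℝ X).symm z, hclusterPt _ hz, ?_⟩
  refine hcompact.tendsto_nhds_of_unique_mapClusterPt (.of_forall hmem) fun y _ hy => ?_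
  exact (toWeakSpace ℝ X).symm.injective (hJ ((hclusterPt _ hy).trans (hclusterPt _ hz).symm))

theorem mem_of_tendsto_toWeakSpace {C : Set X} (hC : Convex ℝ C) (hcl : IsClosed C) {ι : Type*}
    {l : Filter ι} [l.NeBot] {x : ι → X} {z : X} (hxC : ∀ᶠ i in l, x i ∈ C)
    (hx : Tendsto (fun i => toWeakSpace ℝ X (x i)) l (𝓝 (toWeakSpace ℝ X z))) : z ∈ C := by
  have hclosed : IsClosed (toWeakSpace ℝ X '' C) := by
    rw [← hcl.closure_eq, hC.toWeakSpace_closure ℝ]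
    exact isClosed_closure
  exact (toWeakSpace ℝ X).injective.mem_set_image.1
    (hclosed.mem_of_tendsto hx (hxC.mono fun i hi => mem_image_of_mem _ hi))

theorem tendsto_toWeakSpace_iff {ι : Type*} {l : Filter ι} {x : ι → X} {z : X} :
    Tendsto (fun i => toWeakSpace ℝ X (x i)) l (𝓝 (toWeakSpace ℝ X z)) ↔
      ∀ φ : StrongDual ℝ X, Tendsto (fun i => φ (x i)) l (𝓝 (φ z)) :=
  WeakBilin.tendsto_iff_forall_eval_tendsto (topDualPairing ℝ X).flip fun _ _ hxy =>
    (SeparatingDual.eq_iff_forall_dual_eq (R := ℝ)).2 fun φ => LinearMap.congr_fun hxy φ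

end WeakLimits

section Aumann

variable {S X : Type*} [MeasurableSpace S] [NormedAddCommGroup X] [NormedSpace ℝ X]
  {μ : Measure S}

theorem IsReflexiveSpace.exists_mem_tendsto_toWeakSpace_ae (hX : IsReflexiveSpace X)
    [CompleteSpace X] [SeparableSpace X] [IsFiniteMeasure μ] {C : ℕ → Set (Lp X 2 μ)}
    (hC : Antitone C) (hne : ∀ n, (C n).Nonempty) (hconv : ∀ n, Convex ℝ (C n)) {R : ℝ}
    (hR : ∀ h ∈ C 0, ∀ᵐ s ∂μ, ‖h s‖ ≤ R) :
    ∃ (h : ℕ → Lp X 2 μ) (g : S → X), (∀ n, h n ∈ C n) ∧ AEStronglyMeasurable g μ ∧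
      ∀ᵐ s ∂μ, Tendsto (fun n => toWeakSpace ℝ X (h n s)) atTop (𝓝 (toWeakSpace ℝ X (g s))) := by
  obtain ⟨J, hJ⟩ := exists_injective_continuousLinearMap_ell2 (X := X)
  obtain ⟨w, hwC, hw⟩ := exists_cauchySeq_mem_of_antitone_convex
    (D := fun n => J.compLpL 2 μ '' C n) (fun m n hmn => image_mono (hC hmn))
    (fun n => (hne n).image _) (fun n => (hconv n).linear_image (J.compLpL 2 μ).toLinearMap)
    (R := ‖J.compLpL 2 μ‖ * (measureUnivNNReal μ ^ (2 : ℝ≥0∞).toReal⁻¹ * max R 0))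
    (forall_mem_image.2 fun h hh => (J.compLpL 2 μ).le_opNorm_of_le <|
      Lp.norm_le_of_ae_bound (le_max_right R 0) <|
        (hR h hh).mono fun s hs => hs.trans (le_max_left R 0))
  choose k hkC hkw using hwC
  obtain ⟨v, hv⟩ := cauchySeq_tendsto_of_complete hw
  obtain ⟨ns, hns, hae⟩ := (tendstoInMeasure_of_tendsto_Lp hv).exists_seq_tendsto_ae
  have hkns : ∀ i, k (ns i) ∈ C i := fun i => hC (hns.id_le i) (hkC (ns i))
  let IsLimit : S → X → Prop := fun s z => J z = v s ∧
    Tendsto (fun i => toWeakSpace ℝ X (k (ns i) s)) atTop (𝓝 (toWeakSpace ℝ X z))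
  have hlim : ∀ᵐ s ∂μ, ∃ z, IsLimit s z := by
    filter_upwards [hae, ae_all_iff.2 fun i => hR _ (hC i.zero_le (hkns i)),
      ae_all_iff.2 fun i => J.coeFn_compLpL (k (ns i))] with s hs hbdd hJk
    refine hX.exists_tendsto_toWeakSpace hJ (v := v s)
      (isBounded_iff_forall_norm_le.2 ⟨R, forall_mem_range.2 hbdd⟩) (hs.congr fun i => ?_)
    rw [← hkw (ns i), hJk i]
  obtain ⟨g, hg⟩ : ∃ g : S → X, ∀ᵐ s ∂μ, IsLimit s (g s) :=
    ⟨fun s => Classical.epsilon (IsLimit s), hlim.mono fun s hs => Classical.epsilon_spec hs⟩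
  refine ⟨fun i => k (ns i), g, hkns, ?_, hg.mono fun s hs => hs.2⟩
  have := UniformSpace.secondCountable_of_separable X
  borelize X ↥(lp (fun _ : ℕ => ℝ) 2)
  have hJg : AEMeasurable (J ∘ g) μ :=
    (Lp.aestronglyMeasurable v).aemeasurable.congr (hg.mono fun s hs => hs.1.symm)
  exact ((J.continuous.measurableEmbedding hJ).aemeasurable_comp_iff.1 hJg).aestronglyMeasurable

theorem convex_aumannIntegral (μ : Measure S) {F : S → Set X} (hconv : ∀ s, Convex ℝ (F s))
    (A : Set S) : Convex ℝ (aumannIntegral μ F A) := by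
  rintro _ ⟨h, hh, hhF, rfl⟩ _ ⟨k, hk, hkF, rfl⟩ a b ha hb hab
  refine ⟨a • h + b • k, (hh.smul a).add (hk.smul b), ?_, ?_⟩
  · filter_upwards [hhF, hkF] with s hs hs' using hconv s hs hs' ha hb hab
  · rw [integral_add' (hh.integrableOn.smul a) (hk.integrableOn.smul b)]
    simp only [Pi.smul_apply, integral_smul]

theorem zero_mem_aumannIntegral (μ : Measure S) {F : S → Set X} (h0 : ∀ s, (0 : X) ∈ F s)
    (A : Set S) : (0 : X) ∈ aumannIntegral μ F A :=
  ⟨fun _ => 0, integrable_zero _ _ _, .of_forall h0, by simp⟩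

theorem norm_le_of_mem_aumannIntegral [IsFiniteMeasure μ] {F : S → Set X} {R : ℝ}
    (hR : ∀ s, ∀ x ∈ F s, ‖x‖ ≤ R) {A : Set S} {y : X} (hy : y ∈ aumannIntegral μ F A) :
    ‖y‖ ≤ R * μ.real A := by
  obtain ⟨h, -, hhF, rfl⟩ := hy
  exact norm_setIntegral_le_of_norm_le_const_ae (measure_lt_top μ A)
    ((ae_restrict_of_ae hhF).mono fun s hs => hR s _ hs)

/-- The set of `L^p`-selections of a set-valued map `F`, on which the Aumann integral is a convex
image: for bounded `F` and a finite measure they exhaust the integrable selections. -/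
def lpSelections (p : ℝ≥0∞) (μ : Measure S) (F : S → Set X) : Set (Lp X p μ) :=
  {h | ∀ᵐ s ∂μ, h s ∈ F s}

theorem convex_lpSelections (p : ℝ≥0∞) (μ : Measure S) {F : S → Set X}
    (hconv : ∀ s, Convex ℝ (F s)) : Convex ℝ (lpSelections p μ F) := by
  intro h hh k hk a b ha hb hab
  filter_upwards [hh, hk, Lp.coeFn_add (a • h) (b • k), Lp.coeFn_smul a h, Lp.coeFn_smul b k]
    with s hs hs' hadd hah hbk
  rw [hadd, Pi.add_apply, hah, hbk]
  exact hconv s hs hs' ha hb hab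

theorem isLinearMap_setIntegral_Lp [IsFiniteMeasure μ] {p : ℝ≥0∞} [hp : Fact (1 ≤ p)]
    (A : Set S) : IsLinearMap ℝ fun h : Lp X p μ => ∫ s in A, h s ∂μ where
  map_add h k := by
    have hint : ∀ h : Lp X p μ, IntegrableOn h A μ := fun h =>
      ((Lp.memLp h).integrable hp.out).integrableOn
    rw [integral_congr_ae (ae_restrict_of_ae (Lp.coeFn_add h k)), integral_add' (hint h) (hint k)]
  map_smul c h := by
    rw [integral_congr_ae (ae_restrict_of_ae (Lp.coeFn_smul c h))]
    exact integral_smul c _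

theorem aumannIntegral_eq_image_lpSelections [IsFiniteMeasure μ] {p : ℝ≥0∞} (hp : 1 ≤ p)
    {F : S → Set X} {R : ℝ} (hR : ∀ s, ∀ x ∈ F s, ‖x‖ ≤ R) (A : Set S) :
    aumannIntegral μ F A = (fun h : Lp X p μ => ∫ s in A, h s ∂μ) '' lpSelections p μ F := by
  refine Subset.antisymm ?_ ?_
  · rintro _ ⟨h, hh, hhF, rfl⟩
    have hmem : MemLp h p μ :=
      .of_bound hh.aestronglyMeasurable R (hhF.mono fun s hs => hR s _ hs)
    refine ⟨hmem.toLp h, ?_, integral_congr_ae (ae_restrict_of_ae hmem.coeFn_toLp)⟩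
    filter_upwards [hmem.coeFn_toLp, hhF] with s hs hsF
    rwa [hs]
  · rintro _ ⟨h, hh, rfl⟩
    exact ⟨h, (Lp.memLp h).integrable hp, hh, rfl⟩

theorem tendsto_toWeakSpace_integral_of_dominated_convergence [CompleteSpace X]
    {h : ℕ → S → X} {g : S → X} (bound : S → ℝ) (hh : ∀ n, Integrable (h n) μ)
    (hg : Integrable g μ) (hbound : Integrable bound μ)
    (hle : ∀ n, ∀ᵐ s ∂μ, ‖h n s‖ ≤ bound s)
    (hlim : ∀ᵐ s ∂μ,
      Tendsto (fun n => toWeakSpace ℝ X (h n s)) atTop (𝓝 (toWeakSpace ℝ X (g s)))) :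
    Tendsto (fun n => toWeakSpace ℝ X (∫ s, h n s ∂μ)) atTop
      (𝓝 (toWeakSpace ℝ X (∫ s, g s ∂μ))) := by
  refine tendsto_toWeakSpace_iff.2 fun φ => ?_
  simp only [← φ.integral_comp_comm hg, ← φ.integral_comp_comm (hh _)]
  refine tendsto_integral_of_dominated_convergence (fun s => ‖φ‖ * bound s)
    (fun n => φ.continuous.comp_aestronglyMeasurable (hh n).aestronglyMeasurable)
    (hbound.const_mul _) (fun n => (hle n).mono fun s hs => φ.le_opNorm_of_le hs) ?_
  exact hlim.mono fun s hs => tendsto_toWeakSpace_iff.1 hs φ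

theorem IsReflexiveSpace.isClosed_aumannIntegral (hX : IsReflexiveSpace X) [CompleteSpace X]
    [SeparableSpace X] [IsFiniteMeasure μ] {F : S → Set X} (hcl : ∀ s, IsClosed (F s))
    (hconv : ∀ s, Convex ℝ (F s)) {R : ℝ} (hR : ∀ s, ∀ x ∈ F s, ‖x‖ ≤ R) (A : Set S) :
    IsClosed (aumannIntegral μ F A) := by
  refine isClosed_of_closure_subset fun y hy => ?_
  rw [aumannIntegral_eq_image_lpSelections one_le_two hR] at hy
  let r : ℕ → ℝ := fun n => 1 / ((n : ℝ) + 1)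
  have hr : Tendsto r atTop (𝓝 0) := tendsto_one_div_add_atTop_nhds_zero_nat
  let C : ℕ → Set (Lp X 2 μ) := fun n =>
    lpSelections 2 μ F ∩ (fun h : Lp X 2 μ => ∫ s in A, h s ∂μ) ⁻¹' Metric.closedBall y (r n)
  have hanti : Antitone C := fun m n hmn => inter_subset_inter_right _ <|
    preimage_mono <| Metric.closedBall_subset_closedBall <| Nat.one_div_le_one_div hmn
  have hCne : ∀ n, (C n).Nonempty := fun n => by
    obtain ⟨_, ⟨h, hh, rfl⟩, hdist⟩ := Metric.mem_closure_iff.1 hy (r n) Nat.one_div_pos_of_nat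
    exact ⟨h, hh, (dist_comm _ _).trans_le hdist.le⟩
  have hCconv : ∀ n, Convex ℝ (C n) := fun n => (convex_lpSelections 2 μ hconv).inter
    ((convex_closedBall y _).is_linear_preimage (isLinearMap_setIntegral_Lp A))
  have hbdd : ∀ h ∈ lpSelections 2 μ F, ∀ᵐ s ∂μ, ‖h s‖ ≤ R := fun h hh => by
    filter_upwards [hh] with s hs using hR s _ hs
  obtain ⟨h, g, hhC, hgm, hlim⟩ :=
    hX.exists_mem_tendsto_toWeakSpace_ae hanti hCne hCconv fun h hh => hbdd h hh.1
  have hgF : ∀ᵐ s ∂μ, g s ∈ F s := by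
    filter_upwards [hlim, ae_all_iff.2 fun n => (hhC n).1] with s hs hsF
    exact mem_of_tendsto_toWeakSpace (hconv s) (hcl s) (.of_forall hsF) hs
  have hg : Integrable g μ := .of_bound hgm R (hgF.mono fun s hs => hR s _ hs)
  refine ⟨g, hg, hgF, (toWeakSpace ℝ X).injective (tendsto_nhds_unique
    (tendsto_toWeakSpace_integral_of_dominated_convergence (fun _ => R)
      (fun n => ((Lp.memLp (h n)).integrable one_le_two).integrableOn) hg.integrableOn
      (integrable_const R) (fun n => ae_restrict_of_ae (hbdd _ (hhC n).1))
      (ae_restrict_of_ae hlim)) ?_)⟩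
  have hy : Tendsto (fun n => ∫ s in A, h n s ∂μ) atTop (𝓝 y) :=
    tendsto_iff_dist_tendsto_zero.2 (squeeze_zero (fun _ => dist_nonneg) (fun n => (hhC n).2) hr)
  exact ((toWeakSpaceCLM ℝ X).continuous.tendsto y).comp hy

end Aumann

section MeasurableSetMap

variable {S X : Type*} [m : MeasurableSpace S]

theorem isMeasurableSetMap_of_isTopologicalBasis [TopologicalSpace X] [SecondCountableTopology X]
    {B : Set (Set X)} (hB : IsTopologicalBasis B) {F : S → Set X}
    (hF : ∀ U ∈ B, MeasurableSet {s | (F s ∩ U).Nonempty}) : IsMeasurableSetMap m F := by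
  intro O hO
  obtain ⟨B', hB', rfl⟩ := hB.open_eq_sUnion hO
  obtain ⟨T, hTc, hTB', hT⟩ := isOpen_sUnion_countable B' fun U hU => hB.isOpen (hB' hU)
  have hunion : {s | (F s ∩ ⋃₀ B').Nonempty} = ⋃ U ∈ T, {s | (F s ∩ U).Nonempty} := by
    ext s
    simp only [← hT, sUnion_eq_biUnion, inter_iUnion₂, nonempty_iUnion, mem_ofPred_eq, mem_iUnion]
  rw [hunion]
  exact .biUnion hTc fun U hU => hF U (hB' (hTB' hU))

theorem isMeasurableSetMap_iff_measurable_infEDist [PseudoEMetricSpace X] [SeparableSpace X]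
    {F : S → Set X} :
    IsMeasurableSetMap m F ↔ ∀ x, Measurable fun s => Metric.infEDist x (F s) := by
  have hball (x : X) (r : ℝ≥0∞) :
      {s | (F s ∩ Metric.eball x r).Nonempty} = {s | Metric.infEDist x (F s) < r} := by
    ext s
    simp only [mem_ofPred_eq, Metric.infEDist_lt_iff, Set.Nonempty, mem_inter_iff,
      Metric.mem_eball']
  constructor
  · refine fun hF x => measurable_of_Iio fun r => ?_
    exact (hball x r).subst (hF _ Metric.isOpen_eball)
  · intro hF
    have := UniformSpace.secondCountable_of_separable X
    refine isMeasurableSetMap_of_isTopologicalBasis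
      (B := {U | ∃ x r, U = Metric.eball (x : X) r}) ?_ ?_
    · refine isTopologicalBasis_of_isOpen_of_nhds ?_ fun x O hx hO => ?_
      · rintro _ ⟨x, r, rfl⟩
        exact Metric.isOpen_eball
      · obtain ⟨r, hr, hrO⟩ := EMetric.mem_nhds_iff.1 (hO.mem_nhds hx)
        exact ⟨_, ⟨x, r, rfl⟩, Metric.mem_eball_self hr, hrO⟩
    · rintro _ ⟨x, r, rfl⟩
      rw [hball]
      exact measurableSet_lt (hF x) measurable_const

namespace IsMeasurableSetMap

theorem closure [TopologicalSpace X] {F : S → Set X} (hF : IsMeasurableSetMap m F) :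
    IsMeasurableSetMap m fun s => _root_.closure (F s) := by
  intro O hO
  simpa only [closure_inter_open_nonempty_iff hO] using hF O hO

theorem comp {S' : Type*} [m' : MeasurableSpace S'] [TopologicalSpace X] {F : S → Set X}
    (hF : IsMeasurableSetMap m F) {φ : S' → S} (hφ : Measurable φ) :
    IsMeasurableSetMap m' fun s => F (φ s) :=
  fun O hO => hφ (hF O hO)

theorem neg [TopologicalSpace X] [InvolutiveNeg X] [ContinuousNeg X] {F : S → Set X}
    (hF : IsMeasurableSetMap m F) : IsMeasurableSetMap m fun s => -F s := by
  intro O hO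
  convert hF (-O) hO.neg using 3 with s
  rw [← Set.nonempty_neg, Set.inter_neg, neg_neg]

theorem inter_preimage_Ioi [TopologicalSpace X] {F : S → Set X} (hF : IsMeasurableSetMap m F)
    {f : X → ℝ} (hf : Continuous f) {c : S → ℝ} (hc : Measurable c) :
    IsMeasurableSetMap m fun s => F s ∩ f ⁻¹' Ioi (c s) := by
  intro O hO
  have hunion : {s | (F s ∩ f ⁻¹' Ioi (c s) ∩ O).Nonempty} =
      ⋃ q : ℚ, {s | (F s ∩ (f ⁻¹' Ioi (q : ℝ) ∩ O)).Nonempty} ∩ {s | c s < q} := by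
    ext s
    simp only [mem_ofPred_eq, mem_iUnion, mem_inter_iff]
    constructor
    · rintro ⟨y, ⟨hyF, hyf⟩, hyO⟩
      obtain ⟨q, hcq, hqf⟩ := exists_rat_btwn (show c s < f y from hyf)
      exact ⟨q, ⟨y, hyF, hqf, hyO⟩, hcq⟩
    · rintro ⟨q, ⟨y, hyF, hqf, hyO⟩, hcq⟩
      exact ⟨y, ⟨hyF, hcq.trans hqf⟩, hyO⟩
  rw [hunion]
  exact .iUnion fun q => (hF _ ((isOpen_Ioi.preimage hf).inter hO)).inter
    (measurableSet_lt hc measurable_const)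

theorem exists_measurable_inter_ball [PseudoMetricSpace X] [SeparableSpace X] [MeasurableSpace X]
    {F : S → Set X} (hF : IsMeasurableSetMap m F) (hne : ∀ s, (F s).Nonempty) {ε : ℝ}
    (hε : 0 < ε) : ∃ c : S → X, Measurable c ∧
      (IsMeasurableSetMap m fun s => F s ∩ Metric.ball (c s) ε) ∧
      ∀ s, (F s ∩ Metric.ball (c s) ε).Nonempty := by
  classical
  rcases isEmpty_or_nonempty X with hX | hX
  · exact ⟨fun s => (hne s).some, measurable_of_subsingleton_codomain _,
      fun O _ => by simp [Set.eq_empty_of_isEmpty], fun s => isEmptyElim (hne s).some⟩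
  let d := denseSeq X
  have hex : ∀ s, ∃ k, (F s ∩ Metric.ball (d k) ε).Nonempty := fun s => by
    obtain ⟨y, hy⟩ := hne s
    obtain ⟨k, hk⟩ := (denseRange_denseSeq X).exists_dist_lt y hε
    exact ⟨k, y, hy, hk⟩
  have hk : Measurable fun s => Nat.find (hex s) :=
    measurable_find hex fun k => hF _ Metric.isOpen_ball
  refine ⟨fun s => d (Nat.find (hex s)), (measurable_from_nat (f := d)).comp hk, fun O hO => ?_,
    fun s => Nat.find_spec (hex s)⟩
  refine measurableSet_setOfPred.2 <|
    (measurable_from_prod_countable_left (f := fun p : S × ℕ =>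
      (F p.1 ∩ Metric.ball (d p.2) ε ∩ O).Nonempty) fun k => ?_).comp (measurable_id.prodMk hk)
  simpa only [inter_assoc] using measurableSet_setOfPred.1 (hF _ (Metric.isOpen_ball.inter hO))

/- Kuratowski–Ryll-Nardzewski: shrink `F` successively by balls of radius `2⁻ⁿ` with measurable
centres; the centres converge to the selection. -/
theorem exists_measurable_selection [TopologicalSpace X] [PolishSpace X] [MeasurableSpace X]
    [BorelSpace X] {F : S → Set X} (hF : IsMeasurableSetMap m F) (hne : ∀ s, (F s).Nonempty)
    (hcl : ∀ s, IsClosed (F s)) : ∃ g : S → X, Measurable g ∧ ∀ s, g s ∈ F s := by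
  let := upgradeIsCompletelyMetrizable X
  let r : ℕ → ℝ := fun n => (1 / 2) ^ n
  choose c hcm hDm hDne using
    fun (D : {D : S → Set X // IsMeasurableSetMap m D ∧ ∀ s, (D s).Nonempty}) (n : ℕ) =>
      D.2.1.exists_measurable_inter_ball D.2.2 (show 0 < r n by positivity)
  let D (n : ℕ) : {D : S → Set X // IsMeasurableSetMap m D ∧ ∀ s, (D s).Nonempty} :=
    n.rec ⟨F, hF, hne⟩ fun n D => ⟨fun s => D.1 s ∩ Metric.ball (c D n s) (r n), hDm D n, hDne D n⟩
  have hanti : ∀ s, Antitone fun n => (D n).1 s := fun s =>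
    antitone_nat_of_succ_le fun n => inter_subset_left
  choose y hy using fun s n => (D (n + 1)).2.2 s
  have hyc : ∀ s k n, n ≤ k → dist (y s k) (c (D n) n s) < r n := fun s k n hnk =>
    (hanti s (Nat.succ_le_succ hnk) (hy s k)).2
  have hcauchy : ∀ s, CauchySeq (y s) := fun s =>
    cauchySeq_of_le_geometric (1 / 2) 2 (by norm_num) fun n => by
      have := dist_triangle_right (y s n) (y s (n + 1)) (c (D n) n s)
      linarith [hyc s n n le_rfl, hyc s (n + 1) n n.le_succ]
  choose g hg using fun s => cauchySeq_tendsto_of_complete (hcauchy s)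
  have hdist : ∀ s, Tendsto (fun n => dist (y s n) (c (D n) n s)) atTop (𝓝 0) := fun s =>
    squeeze_zero (fun _ => dist_nonneg) (fun n => (hyc s n n le_rfl).le)
      (tendsto_pow_atTop_nhds_zero_of_lt_one (by norm_num) (by norm_num))
  refine ⟨g, measurable_of_tendsto_metrizable (fun n => hcm (D n) n)
    (tendsto_pi_nhds.2 fun s => (tendsto_iff_of_dist (hdist s)).1 (hg s)), fun s => ?_⟩
  exact (hcl s).mem_of_tendsto (hg s) (.of_forall fun n => hanti s n.succ.zero_le (hy s n))

end IsMeasurableSetMap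

theorem IsRandomClosedSet.neg [TopologicalSpace X] [InvolutiveNeg X] [ContinuousNeg X]
    {F : S → Set X} (hF : IsRandomClosedSet m F) : IsRandomClosedSet m fun s => -F s :=
  ⟨fun s => (hF.nonempty s).neg, fun s => (hF.isClosed s).neg, hF.measurable.neg⟩

end MeasurableSetMap

section SupportFunction

variable {X : Type*} [NormedAddCommGroup X] [NormedSpace ℝ X] {C : Set X}

/-- The support function `f ↦ sup_{x ∈ C} f x` of a set, as a function on the dual space. It is
real-valued, so it is only meaningful for `C` non-empty and bounded. -/
noncomputable def supportFunction (C : Set X) (f : StrongDual ℝ X) : ℝ :=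
  sSup (f '' C)

theorem bddAbove_image_strongDual (hC : Bornology.IsBounded C) (f : StrongDual ℝ X) :
    BddAbove (f '' C) :=
  (f.lipschitz.isBounded_image hC).bddAbove

theorem le_supportFunction (hC : Bornology.IsBounded C) (f : StrongDual ℝ X) {x : X}
    (hx : x ∈ C) : f x ≤ supportFunction C f :=
  le_csSup (bddAbove_image_strongDual hC f) (mem_image_of_mem f hx)

theorem supportFunction_le (hne : C.Nonempty) {f : StrongDual ℝ X} {c : ℝ}
    (h : ∀ x ∈ C, f x ≤ c) : supportFunction C f ≤ c :=
  csSup_le (hne.image f) (forall_mem_image.2 h)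

theorem lt_supportFunction_iff (hne : C.Nonempty) (hC : Bornology.IsBounded C)
    {f : StrongDual ℝ X} {c : ℝ} : c < supportFunction C f ↔ ∃ x ∈ C, c < f x := by
  rw [supportFunction, lt_csSup_iff (bddAbove_image_strongDual hC f) (hne.image f),
    exists_mem_image]

theorem lipschitzWith_supportFunction (hne : C.Nonempty) {R : NNReal} (hR : ∀ x ∈ C, ‖x‖ ≤ R) :
    LipschitzWith R (supportFunction C) :=
  .of_le_add_mul R fun f g => supportFunction_le hne fun x hx => by
    have hdiff : f x - g x ≤ R * dist f g := calc
      f x - g x ≤ ‖(f - g) x‖ := le_abs_self ((f - g) x)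
      _ ≤ ‖f - g‖ * R := (f - g).le_opNorm_of_le (hR x hx)
      _ = R * dist f g := by rw [dist_eq_norm, mul_comm]
    linarith [le_supportFunction (isBounded_iff_forall_norm_le.2 ⟨R, hR⟩) g hx]

theorem abs_supportFunction_le (hne : C.Nonempty) {R : ℝ} (hR : ∀ x ∈ C, ‖x‖ ≤ R)
    (f : StrongDual ℝ X) : |supportFunction C f| ≤ ‖f‖ * R := by
  have hf : ∀ x ∈ C, |f x| ≤ ‖f‖ * R := fun x hx => f.le_opNorm_of_le (hR x hx)
  obtain ⟨x, hx⟩ := id hne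
  exact abs_le.2 ⟨(neg_le_of_abs_le (hf x hx)).trans
    (le_supportFunction (isBounded_iff_forall_norm_le.2 ⟨R, hR⟩) f hx),
    supportFunction_le hne fun y hy => le_of_abs_le (hf y hy)⟩

theorem add_mul_norm_le_of_forall_mem_ball {f : StrongDual ℝ X} {x : X} {r c : ℝ} (hr : 0 < r)
    (h : ∀ y ∈ Metric.ball x r, f y ≤ c) : f x + r * ‖f‖ ≤ c := by
  have hclosed : ∀ y ∈ Metric.closedBall x r, f y ≤ c := by
    rw [← closure_ball x hr.ne']
    exact closure_minimal h (isClosed_Iic.preimage f.continuous)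
  suffices ‖f‖ ≤ (c - f x) / r by
    rw [le_div_iff₀ hr] at this
    linarith
  refine f.opNorm_le_of_unit_norm
    (div_nonneg (sub_nonneg.2 (h x (Metric.mem_ball_self hr))) hr.le) fun z hz => ?_
  have hsphere : ∀ w : X, ‖w‖ = 1 → f w ≤ (c - f x) / r := fun w hw => by
    have := hclosed (x + r • w) (by simp [norm_smul, hw, abs_of_pos hr])
    rw [map_add, map_smul, smul_eq_mul] at this
    rw [le_div_iff₀ hr]
    linarith
  exact abs_le'.2 ⟨hsphere z hz, by simpa using hsphere (-z) (by rwa [norm_neg])⟩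

theorem exists_norm_le_one_infDist_le_apply_sub (hconv : Convex ℝ C) (x : X) :
    ∃ f : StrongDual ℝ X, ‖f‖ ≤ 1 ∧ ∀ c ∈ C, Metric.infDist x C ≤ f x - f c := by
  rcases C.eq_empty_or_nonempty with rfl | ⟨c₀, hc₀⟩
  · exact ⟨0, by simp⟩
  rcases (Metric.infDist_nonneg (x := x) (s := C)).eq_or_lt with hd | hd
  · exact ⟨0, by simp [← hd]⟩
  obtain ⟨g, v, hball, hC⟩ := geometric_hahn_banach_open (convex_ball x (Metric.infDist x C))
    Metric.isOpen_ball hconv Metric.disjoint_ball_infDist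
  have hg : 0 < ‖g‖ := by
    refine norm_pos_iff.2 fun hg => ?_
    have hlt := (hball x (Metric.mem_ball_self hd)).trans_le (hC c₀ hc₀)
    simp [hg] at hlt
  have hv := add_mul_norm_le_of_forall_mem_ball hd fun y hy => (hball y hy).le
  refine ⟨-(‖g‖⁻¹ • g), by simp [norm_smul, hg.ne'], fun c hc => ?_⟩
  calc Metric.infDist x C ≤ (g c - g x) / ‖g‖ := by
        rw [le_div_iff₀ hg]
        linarith [hC c hc]
    _ = (-(‖g‖⁻¹ • g)) x - (-(‖g‖⁻¹ • g)) c := by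
        simp only [neg_apply, smul_apply, smul_eq_mul]
        ring

theorem isLUB_apply_sub_supportFunction (hne : C.Nonempty) (hC : Bornology.IsBounded C)
    (hconv : Convex ℝ C) (x : X) :
    IsLUB ((fun f => f x - supportFunction C f) '' Metric.closedBall (0 : StrongDual ℝ X) 1)
      (Metric.infDist x C) := by
  constructor
  · rintro _ ⟨f, hf, rfl⟩
    refine (Metric.le_infDist hne).2 fun c hc => ?_
    calc f x - supportFunction C f ≤ f x - f c := by gcongr; exact le_supportFunction hC f hc
      _ = f (x - c) := (map_sub f x c).symm
      _ ≤ 1 * ‖x - c‖ := (le_abs_self _).trans (f.le_of_opNorm_le (by simpa using hf) _)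
      _ = dist x c := by rw [one_mul, dist_eq_norm]
  · obtain ⟨f, hf, hfC⟩ := exists_norm_le_one_infDist_le_apply_sub hconv x
    intro b hb
    have hsupp : supportFunction C f ≤ f x - Metric.infDist x C :=
      supportFunction_le hne fun c hc => by linarith [hfC c hc]
    have hfb : f x - supportFunction C f ≤ b := hb (mem_image_of_mem _ (by simpa using hf))
    linarith

theorem isLUB_range_comp_iff_of_denseRange {ι β α : Type*} [TopologicalSpace β] [TopologicalSpace α]
    [Preorder α] [ClosedIicTopology α] {φ : β → α} (hφ : Continuous φ) {e : ι → β}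
    (he : DenseRange e) {a : α} : IsLUB (range (φ ∘ e)) a ↔ IsLUB (range φ) a := by
  suffices upperBounds (range (φ ∘ e)) = upperBounds (range φ) by rw [IsLUB, IsLUB, this]
  refine Subset.antisymm (fun b hb => ?_) (upperBounds_mono_set (range_comp_subset_range e φ))
  exact forall_mem_range.2 (isClosed_property he (isClosed_Iic.preimage hφ) fun i =>
    hb (mem_range_self i))

namespace IsMeasurableSetMap

variable {S : Type*} [m : MeasurableSpace S] {F : S → Set X}

theorem measurable_supportFunction (hF : IsMeasurableSetMap m F) (hne : ∀ s, (F s).Nonempty)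
    (hbdd : ∀ s, Bornology.IsBounded (F s)) (f : StrongDual ℝ X) :
    Measurable fun s => supportFunction (F s) f := by
  refine measurable_of_Ioi fun c => ?_
  convert hF (f ⁻¹' Ioi c) (isOpen_Ioi.preimage f.continuous) using 1
  ext s
  exact lt_supportFunction_iff (hne s) (hbdd s)

theorem of_measurable_supportFunction [SeparableSpace (StrongDual ℝ X)]
    (hne : ∀ s, (F s).Nonempty) (hbdd : ∀ s, Bornology.IsBounded (F s))
    (hconv : ∀ s, Convex ℝ (F s)) (h : ∀ f, Measurable fun s => supportFunction (F s) f) :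
    IsMeasurableSetMap m F := by
  have : SeparableSpace X := separableSpace_of_separableSpace_dual
  refine isMeasurableSetMap_iff_measurable_infEDist.2 fun x => ?_
  suffices Measurable fun s => Metric.infDist x (F s) by
    simpa only [Metric.infDist, ENNReal.ofReal_toReal (Metric.infEDist_ne_top (hne _))]
      using this.ennreal_ofReal
  have := UniformSpace.secondCountable_of_separable (StrongDual ℝ X)
  let B := Metric.closedBall (0 : StrongDual ℝ X) 1
  have : Nonempty B := ⟨0, Metric.mem_closedBall_self zero_le_one⟩
  refine Measurable.isLUB
    (f := fun n s => (denseSeq B n).1 x - supportFunction (F s) (denseSeq B n))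
    (fun n => measurable_const.sub (h _)) fun s => ?_
  obtain ⟨R, hR⟩ := (hbdd s).exists_norm_le
  have hcont : Continuous (supportFunction (F s)) := (lipschitzWith_supportFunction (hne s)
    (R := R.toNNReal) fun c hc => (hR c hc).trans (Real.le_coe_toNNReal R)).continuous
  refine (isLUB_range_comp_iff_of_denseRange (φ := fun f : B => f.1 x - supportFunction (F s) f)
    (by fun_prop) (denseRange_denseSeq B)).2 ?_
  simpa only [image_eq_range] using isLUB_apply_sub_supportFunction (hne s) (hbdd s) (hconv s) x

end IsMeasurableSetMap

end SupportFunction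

section SupportFunctionAumann

variable {S X : Type*} [m : MeasurableSpace S] [NormedAddCommGroup X] [NormedSpace ℝ X]
  {F : S → Set X}

namespace IsMeasurableSetMap

theorem integrable_supportFunction {μ : Measure S} [IsFiniteMeasure μ]
    (hF : IsMeasurableSetMap m F) (hne : ∀ s, (F s).Nonempty) {R : ℝ}
    (hR : ∀ s, ∀ x ∈ F s, ‖x‖ ≤ R) (f : StrongDual ℝ X) :
    Integrable (fun s => supportFunction (F s) f) μ :=
  .of_bound (hF.measurable_supportFunction hne
      (fun s => isBounded_iff_forall_norm_le.2 ⟨R, hR s⟩) f).aestronglyMeasurable (‖f‖ * R)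
    (.of_forall fun s => abs_supportFunction_le (hne s) (hR s) f)

theorem exists_measurable_selection_supportFunction_sub_le [CompleteSpace X] [SeparableSpace X]
    [MeasurableSpace X] [BorelSpace X] (hF : IsMeasurableSetMap m F) (hne : ∀ s, (F s).Nonempty)
    (hcl : ∀ s, IsClosed (F s)) (hbdd : ∀ s, Bornology.IsBounded (F s)) (f : StrongDual ℝ X)
    {δ : ℝ} (hδ : 0 < δ) : ∃ g : S → X, Measurable g ∧
      ∀ s, g s ∈ F s ∧ supportFunction (F s) f - δ ≤ f (g s) := by
  have := UniformSpace.secondCountable_of_separable X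
  obtain ⟨g, hgm, hg⟩ := ((hF.inter_preimage_Ioi f.continuous
    ((hF.measurable_supportFunction hne hbdd f).sub_const δ)).closure).exists_measurable_selection
      (fun s => by
        obtain ⟨x, hx, hlt⟩ :=
          (lt_supportFunction_iff (hne s) (hbdd s)).1 (sub_lt_self (supportFunction (F s) f) hδ)
        exact ⟨x, subset_closure ⟨hx, hlt⟩⟩)
      fun s => isClosed_closure
  refine ⟨g, hgm, fun s => closure_minimal (t := F s ∩ f ⁻¹' Ici (supportFunction (F s) f - δ))
    (inter_subset_inter_right _ (preimage_mono Ioi_subset_Ici_self))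
    ((hcl s).inter (isClosed_Ici.preimage f.continuous)) (hg s)⟩

theorem nonempty_aumannIntegral [CompleteSpace X] [SeparableSpace X] {μ : Measure S}
    [IsFiniteMeasure μ] (hF : IsMeasurableSetMap m F) (hne : ∀ s, (F s).Nonempty)
    (hcl : ∀ s, IsClosed (F s)) {R : ℝ} (hR : ∀ s, ∀ x ∈ F s, ‖x‖ ≤ R) (A : Set S) :
    (_root_.aumannIntegral μ F A).Nonempty := by
  have := UniformSpace.secondCountable_of_separable X
  borelize X
  obtain ⟨g, hg, hgF⟩ := hF.exists_measurable_selection hne hcl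
  exact ⟨_, g, .of_bound hg.aestronglyMeasurable R (.of_forall fun s => hR s _ (hgF s)),
    .of_forall hgF, rfl⟩

end IsMeasurableSetMap

theorem supportFunction_aumannIntegral [CompleteSpace X] [SeparableSpace X] {μ : Measure S}
    [IsFiniteMeasure μ] (hF : IsMeasurableSetMap m F) (hne : ∀ s, (F s).Nonempty)
    (hcl : ∀ s, IsClosed (F s)) {R : ℝ} (hR : ∀ s, ∀ x ∈ F s, ‖x‖ ≤ R) (A : Set S)
    (f : StrongDual ℝ X) :
    supportFunction (aumannIntegral μ F A) f = ∫ s in A, supportFunction (F s) f ∂μ := by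
  have := UniformSpace.secondCountable_of_separable X
  borelize X
  have hbdd : ∀ s, Bornology.IsBounded (F s) := fun s => isBounded_iff_forall_norm_le.2 ⟨R, hR s⟩
  have hint : IntegrableOn (fun s => supportFunction (F s) f) A μ :=
    (hF.integrable_supportFunction hne hR f).integrableOn
  have happrox : ∀ δ > 0, ∃ y ∈ aumannIntegral μ F A,
      ∫ s in A, supportFunction (F s) f ∂μ - μ.real A * δ ≤ f y := fun δ hδ => by
    obtain ⟨g, hgm, hg⟩ :=
      hF.exists_measurable_selection_supportFunction_sub_le hne hcl hbdd f hδ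
    have hgi : Integrable g μ :=
      .of_bound hgm.aestronglyMeasurable R (.of_forall fun s => hR s _ (hg s).1)
    refine ⟨_, ⟨g, hgi, .of_forall fun s => (hg s).1, rfl⟩, ?_⟩
    rw [← f.integral_comp_comm hgi.integrableOn, ← smul_eq_mul, ← setIntegral_const,
      ← integral_sub hint (integrable_const δ)]
    exact integral_mono (hint.sub (integrable_const δ)) (f.integrable_comp hgi.integrableOn)
      fun s => (hg s).2
  refine le_antisymm (supportFunction_le (hF.nonempty_aumannIntegral hne hcl hR A) ?_) ?_
  · rintro _ ⟨g, hg, hgF, rfl⟩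
    rw [← f.integral_comp_comm hg.integrableOn]
    exact integral_mono_ae (f.integrable_comp hg.integrableOn) hint
      ((ae_restrict_of_ae hgF).mono fun s hs => le_supportFunction (hbdd s) f hs)
  · have hlim : Tendsto (fun δ => ∫ s in A, supportFunction (F s) f ∂μ - μ.real A * δ) (𝓝[>] 0)
        (𝓝 (∫ s in A, supportFunction (F s) f ∂μ)) := by
      refine tendsto_nhdsWithin_of_tendsto_nhds (Continuous.tendsto' ?_ _ _ ?_)
      · fun_prop
      · rw [mul_zero, sub_zero]
    refine le_of_tendsto hlim (eventually_mem_nhdsWithin.mono fun δ hδ => ?_)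
    obtain ⟨y, hy, hle⟩ := happrox δ hδ
    exact hle.trans (le_supportFunction (isBounded_iff_forall_norm_le.2
      ⟨_, fun _ => norm_le_of_mem_aumannIntegral hR⟩) f hy)

theorem IsMeasurableSetMap.aumannIntegral {Ω : Type*} [mΩ : MeasurableSpace Ω] [CompleteSpace X]
    [SeparableSpace (StrongDual ℝ X)] {μ : Measure S} [IsFiniteMeasure μ] {G : Ω → S → Set X}
    (hG : IsMeasurableSetMap inferInstance fun p : Ω × S => G p.1 p.2)
    (hne : ∀ ω s, (G ω s).Nonempty) (hcl : ∀ ω s, IsClosed (G ω s))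
    (hconv : ∀ ω s, Convex ℝ (G ω s)) {R : ℝ} (hR : ∀ ω s, ∀ x ∈ G ω s, ‖x‖ ≤ R) (A : Set S) :
    IsMeasurableSetMap mΩ fun ω => _root_.aumannIntegral μ (G ω) A := by
  have : SeparableSpace X := separableSpace_of_separableSpace_dual
  have hGω : ∀ ω, IsMeasurableSetMap m (G ω) := fun ω => hG.comp measurable_prodMk_left
  refine .of_measurable_supportFunction
    (fun ω => (hGω ω).nonempty_aumannIntegral (hne ω) (hcl ω) (hR ω) A) (fun ω => ?_)
    (fun ω => convex_aumannIntegral μ (hconv ω) A) fun f => ?_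
  · exact isBounded_iff_forall_norm_le.2 ⟨_, fun _ => norm_le_of_mem_aumannIntegral (hR ω)⟩
  · simp only [supportFunction_aumannIntegral (hGω _) (hne _) (hcl _) (hR _) A f]
    exact (hG.measurable_supportFunction (fun p => hne p.1 p.2) (fun p =>
      isBounded_iff_forall_norm_le.2 ⟨R, hR p.1 p.2⟩) f).stronglyMeasurable.integral_prod_right
        |>.measurable

end SupportFunctionAumann

section LeftContinuous

variable {Ω : Type*} [m : MeasurableSpace Ω]

theorem tendsto_floor_mul_div_nhdsWithin_Iic (u : ℝ) :
    Tendsto (fun n : ℕ => (⌊u * (n + 1)⌋ : ℝ) / (n + 1)) atTop (𝓝[≤] u) := by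
  have hle : ∀ n : ℕ, (⌊u * (n + 1)⌋ : ℝ) / (n + 1) ≤ u := fun n => by
    rw [div_le_iff₀ (by positivity)]
    exact Int.floor_le _
  have hge : ∀ n : ℕ, u - 1 / (n + 1) ≤ (⌊u * (n + 1)⌋ : ℝ) / (n + 1) := fun n => by
    rw [le_div_iff₀ (by positivity), sub_mul, one_div_mul_cancel (by positivity)]
    exact (Int.sub_one_lt_floor _).le
  refine tendsto_nhdsWithin_iff.2
    ⟨tendsto_of_tendsto_of_tendsto_of_le_of_le ?_ tendsto_const_nhds hge hle, .of_forall hle⟩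
  simpa using tendsto_one_div_add_atTop_nhds_zero_nat.const_sub u

theorem measurable_uncurry_of_continuousWithinAt_Iic {Y : Type*} [TopologicalSpace Y]
    [PseudoMetrizableSpace Y] [MeasurableSpace Y] [BorelSpace Y] {f : Ω → ℝ → Y}
    (hf : ∀ t, Measurable fun ω => f ω t) (hleft : ∀ ω t, ContinuousWithinAt (f ω) (Iic t) t) :
    Measurable fun p : Ω × ℝ => f p.1 p.2 := by
  refine measurable_of_tendsto_metrizable
    (f := fun (n : ℕ) (p : Ω × ℝ) => f p.1 (⌊p.2 * (n + 1)⌋ / (n + 1))) (fun n => ?_)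
    (tendsto_pi_nhds.2 fun p =>
      (hleft p.1 p.2).tendsto.comp (tendsto_floor_mul_div_nhdsWithin_Iic p.2))
  have hfloor : Measurable fun p : Ω × ℝ => (p.1, ⌊p.2 * (n + 1)⌋) := by fun_prop
  exact (measurable_from_prod_countable_left (f := fun p : Ω × ℤ => f p.1 (p.2 / (n + 1)))
    fun k => hf (k / (n + 1))).comp hfloor

theorem measurable_uncurry_of_continuousWithinAt_Iic_Icc {Y : Type*} [TopologicalSpace Y]
    [PseudoMetrizableSpace Y] [MeasurableSpace Y] [BorelSpace Y] {t₀ T : ℝ}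
    {f : Ω → Icc t₀ T → Y} (hf : ∀ t, Measurable fun ω => f ω t)
    (hleft : ∀ ω t, ContinuousWithinAt (f ω) (Iic t) t) :
    Measurable fun p : Ω × Icc t₀ T => f p.1 p.2 := by
  rcases isEmpty_or_nonempty (Icc t₀ T) with hT | ⟨⟨t, ht⟩⟩
  · exact measurable_of_empty _
  have hT : t₀ ≤ T := ht.1.trans ht.2
  have hext : Measurable fun p : Ω × ℝ => f p.1 (projIcc t₀ T hT p.2) :=
    measurable_uncurry_of_continuousWithinAt_Iic (fun u => hf _) fun ω u =>
      (hleft ω (projIcc t₀ T hT u)).comp continuous_projIcc.continuousWithinAt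
        fun v hv => monotone_projIcc hT hv
  have hcoe : Measurable fun p : Ω × Icc t₀ T => (p.1, (p.2 : ℝ)) := by fun_prop
  simpa only [Function.comp_def, projIcc_val] using hext.comp hcoe

theorem tendsto_infEDist_of_tendsto_hausdorffEDist {X ι : Type*} [PseudoEMetricSpace X]
    {l : Filter ι} {C : ι → Set X} {D : Set X} (x : X)
    (h : Tendsto (fun i => Metric.hausdorffEDist (C i) D) l (𝓝 0)) :
    Tendsto (fun i => Metric.infEDist x (C i)) l (𝓝 (Metric.infEDist x D)) := by
  refine tendsto_of_tendsto_of_tendsto_of_le_of_le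
    (g := fun i => Metric.infEDist x D - Metric.hausdorffEDist (C i) D)
    (h := fun i => Metric.infEDist x D + Metric.hausdorffEDist D (C i)) ?_ ?_
    (fun i => tsub_le_iff_right.2 Metric.infEDist_le_infEDist_add_hausdorffEDist)
    fun i => Metric.infEDist_le_infEDist_add_hausdorffEDist
  · simpa using ENNReal.Tendsto.sub tendsto_const_nhds h (.inr ENNReal.zero_ne_top)
  · simpa [Metric.hausdorffEDist_comm] using h.const_add (Metric.infEDist x D)

theorem isMeasurableSetMap_uncurry_of_leftContinuous {X : Type*} [PseudoEMetricSpace X]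
    [SeparableSpace X] {t₀ T : ℝ} {H : Ω → Icc t₀ T → Set X}
    (hmeas : ∀ t, IsMeasurableSetMap m fun ω => H ω t)
    (hleft : ∀ ω u, Tendsto (fun t => Metric.hausdorffEDist (H ω t) (H ω u)) (𝓝[<] u) (𝓝 0)) :
    IsMeasurableSetMap inferInstance fun p : Ω × Icc t₀ T => H p.1 p.2 := by
  refine isMeasurableSetMap_iff_measurable_infEDist.2 fun x => ?_
  refine measurable_uncurry_of_continuousWithinAt_Iic_Icc
    (f := fun ω t => Metric.infEDist x (H ω t))
    (fun t => isMeasurableSetMap_iff_measurable_infEDist.1 (hmeas t) x) fun ω u => ?_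
  exact continuousWithinAt_Iio_iff_Iic.1 (tendsto_infEDist_of_tendsto_hausdorffEDist x (hleft ω u))

end LeftContinuous

section Predictable

variable {S Ω X : Type*} [m : MeasurableSpace Ω] {P : Measure Ω}

namespace IsMeasurableSetMap

open scoped Classical in
theorem piecewise [TopologicalSpace X] {N : Set Ω} (hN : MeasurableSet N) {F F' : Ω → Set X}
    (hF : IsMeasurableSetMap m F) (hF' : IsMeasurableSetMap m F') :
    IsMeasurableSetMap m (N.piecewise F F') := by
  intro O hO
  convert hN.ite (hF O hO) (hF' O hO) using 1
  ext ω
  by_cases hω : ω ∈ N <;> simp [hω, Set.ite]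

theorem congr_ae [TopologicalSpace X] [P.IsComplete] {F F' : Ω → Set X}
    (hF : IsMeasurableSetMap m F) (h : F =ᵐ[P] F') : IsMeasurableSetMap m F' := by
  intro O hO
  refine NullMeasurableSet.measurable_of_complete (μ := P) ((hF O hO).nullMeasurableSet.congr ?_)
  filter_upwards [h] with ω hω
  change (F ω ∩ O).Nonempty = (F' ω ∩ O).Nonempty
  rw [hω]

end IsMeasurableSetMap

theorem exists_isMeasurableSetMap_uncurry_of_eventuallyMeasurableSpace {ι : Type*}
    [mι : MeasurableSpace ι] [TopologicalSpace X] [SecondCountableTopology X] {G : Ω → ι → Set X}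
    (hG : IsMeasurableSetMap
      (eventuallyMeasurableSpace (m.prod mι) ((ae P).comap Prod.fst)) fun p => G p.1 p.2)
    (D : Set X) :
    ∃ G' : Ω → ι → Set X, IsMeasurableSetMap (m.prod mι) (fun p => G' p.1 p.2) ∧ G' =ᵐ[P] G ∧
      ∀ ω, G' ω = G ω ∨ G' ω = fun _ => D := by
  classical
  obtain ⟨b, hbc, -, hb⟩ := exists_countable_basis X
  have := hbc.to_subtype
  choose A hA hGA using fun U : b => hG U (hb.isOpen U.2)
  obtain ⟨Ω₀, hΩ₀, hsub⟩ := mem_comap.1 (eventually_countable_forall.2 hGA)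
  let N := toMeasurable P Ω₀ᶜ
  have hN : MeasurableSet N := measurableSet_toMeasurable P _
  have hNnull : P N = 0 := by rwa [measure_toMeasurable]
  have hGA' : ∀ U : b, ∀ p : Ω × ι, p.1 ∉ N → ((G p.1 p.2 ∩ U).Nonempty ↔ p ∈ A U) :=
    fun U p hp => iff_of_eq (hsub (show p.1 ∈ Ω₀ from of_not_not fun h =>
      hp (subset_toMeasurable P _ h)) U)
  refine ⟨N.piecewise (fun _ _ => D) G, isMeasurableSetMap_of_isTopologicalBasis hb fun U hU => ?_,
    ?_, fun ω => ?_⟩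
  · have hite : {p : Ω × ι | (N.piecewise (fun _ _ => D) G p.1 p.2 ∩ U).Nonempty} =
        (Prod.fst ⁻¹' N).ite {_p | (D ∩ U).Nonempty} (A ⟨U, hU⟩) := by
      ext p
      by_cases hp : p.1 ∈ N
      · simp [Set.ite, hp]
      · simp [Set.ite, hp, ← hGA' ⟨U, hU⟩ p hp]
    rw [hite]
    exact (measurable_fst hN).ite (.const _) (hA ⟨U, hU⟩)
  · filter_upwards [measure_eq_zero_iff_ae_notMem.1 hNnull] with ω hω
    exact piecewise_eq_of_notMem _ _ _ hω
  · by_cases hω : ω ∈ N <;> simp [hω]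

theorem IsLeftContinuousAdapted.exists_leftContinuous_ae_eq [NormedAddCommGroup X] {t₀ T : ℝ}
    {𝓕 : Filtration (Icc t₀ T) m} {H : Ω → Icc t₀ T → Set X}
    (hH : IsLeftContinuousAdapted X 𝓕 P H) :
    ∃ H' : Ω → Icc t₀ T → Set X, (∀ t, IsMeasurableSetMap m fun ω => H' ω t) ∧
      (∀ ω u, Tendsto (fun t => Metric.hausdorffEDist (H' ω t) (H' ω u)) (𝓝[<] u) (𝓝 0)) ∧
      H' =ᵐ[P] H := by
  classical
  let Ω₀ := {ω | ∀ u, Tendsto (fun t => Metric.hausdorffEDist (H ω t) (H ω u)) (𝓝[<] u) (𝓝 0)}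
  let N := toMeasurable P Ω₀ᶜ
  have hN : MeasurableSet N := measurableSet_toMeasurable P _
  have hNnull : P N = 0 := by
    rw [measure_toMeasurable]
    exact hH.leftContinuous
  refine ⟨N.piecewise (fun _ _ => {0}) H, fun t => ?_, fun ω u => ?_, ?_⟩
  · have hconst : IsMeasurableSetMap m fun _ : Ω => ({0} : Set X) := fun O _ => .const _
    have hHt : IsMeasurableSetMap m fun ω => H ω t :=
      fun O hO => 𝓕.le t _ ((hH.adapted t).measurable O hO)
    convert hconst.piecewise hN hHt using 2 with ω
    by_cases hω : ω ∈ N <;> simp [hω]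
  · by_cases hω : ω ∈ N
    · simpa [hω, Metric.hausdorffEDist_self] using tendsto_const_nhds
    · simpa [hω] using
        (show ω ∈ Ω₀ from of_not_not fun h => hω (subset_toMeasurable P _ h)) u
  · filter_upwards [measure_eq_zero_iff_ae_notMem.1 hNnull] with ω hω
    exact piecewise_eq_of_notMem _ _ _ hω

theorem predictableSigmaAlgebra_le_eventuallyMeasurableSpace [NormedAddCommGroup X]
    [SeparableSpace X] {t₀ T : ℝ} (𝓕 : Filtration (Icc t₀ T) m) (P : Measure Ω) :
    predictableSigmaAlgebra X 𝓕 P ≤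
      eventuallyMeasurableSpace (m.prod inferInstance) ((ae P).comap Prod.fst) := by
  refine MeasurableSpace.generateFrom_le ?_
  rintro _ ⟨H, O, hH, hO, rfl⟩
  obtain ⟨H', hmeas, hleft, hae⟩ := hH.exists_leftContinuous_ae_eq
  refine ⟨_, isMeasurableSetMap_uncurry_of_leftContinuous hmeas hleft O hO, ?_⟩
  filter_upwards [tendsto_comap.eventually hae] with p hp
  change (H p.1 p.2 ∩ O).Nonempty = (H' p.1 p.2 ∩ O).Nonempty
  rw [hp]

end Predictable

section Main

variable {Ω X : Type*} [m : MeasurableSpace Ω] [NormedAddCommGroup X] [NormedSpace ℝ X]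
  [CompleteSpace X] {t₀ T : ℝ}

instance isFiniteMeasure_lebesgueIcc (t₀ T : ℝ) : IsFiniteMeasure (lebesgueIcc t₀ T) := by
  refine ⟨?_⟩
  rw [lebesgueIcc, comap_subtype_coe_apply measurableSet_Icc, image_univ, Subtype.range_coe]
  exact measure_Icc_lt_top

theorem isMeasurableSetMap_aumannIntegral_of_predictable [SeparableSpace (StrongDual ℝ X)]
    {P : Measure Ω} [P.IsComplete] {𝓕 : Filtration (Icc t₀ T) m} {μ : Measure (Icc t₀ T)}
    [IsFiniteMeasure μ] {G : Ω → Icc t₀ T → Set X}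
    (hpred : IsMeasurableSetMap (predictableSigmaAlgebra X 𝓕 P) fun p => G p.1 p.2)
    (hcl : ∀ ω t, IsClosed (G ω t)) (hzero : ∀ ω t, (0 : X) ∈ G ω t)
    (hconv : ∀ ω t, Convex ℝ (G ω t)) {R : ℝ} (hR : ∀ ω t, ∀ x ∈ G ω t, ‖x‖ ≤ R)
    (A : Set (Icc t₀ T)) : IsMeasurableSetMap m fun ω => aumannIntegral μ (G ω) A := by
  have : SeparableSpace X := separableSpace_of_separableSpace_dual
  have := UniformSpace.secondCountable_of_separable X
  obtain ⟨G', hG', hae, hcases⟩ := exists_isMeasurableSetMap_uncurry_of_eventuallyMeasurableSpace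
    (fun O hO => predictableSigmaAlgebra_le_eventuallyMeasurableSpace 𝓕 P _ (hpred O hO)) {0}
  have hzero' : ∀ ω t, (0 : X) ∈ G' ω t := fun ω t => by
    rcases hcases ω with h | h <;> simp [h, hzero]
  have hG'A : IsMeasurableSetMap m fun ω => aumannIntegral μ (G' ω) A :=
    hG'.aumannIntegral (R := R) (fun ω t => ⟨0, hzero' ω t⟩)
      (fun ω t => by rcases hcases ω with h | h <;> simp [h, hcl])
      (fun ω t => by rcases hcases ω with h | h <;> simp [h, hconv])
      (fun ω t x hx => by
        rcases hcases ω with h | h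
        · exact hR ω t x (h ▸ hx)
        · rw [h, mem_singleton_iff] at hx
          exact hR ω t x (hx ▸ hzero ω t))
      A
  refine hG'A.congr_ae (P := P) ?_
  filter_upwards [hae] with ω hω
  rw [hω]

end Main

theorem mainTheorem3_general
    {X : Type*} [NormedAddCommGroup X] [NormedSpace ℝ X] [CompleteSpace X]
    (hrefl : IsReflexiveSpace X) [SeparableSpace (StrongDual ℝ X)]
    {t₀ T : ℝ} {Ω : Type*} {m : MeasurableSpace Ω} (P : Measure Ω) [P.IsComplete]
    (𝓕 : Filtration (Icc t₀ T) m) (G : Ω → Icc t₀ T → Set X)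
    (hclosed : ∀ ω t, IsClosed (G ω t))
    (hzero : ∀ ω t, (0 : X) ∈ G ω t)
    (hconvex : ∀ ω t, Convex ℝ (G ω t))
    (hbounded : ∃ K : Set X, Bornology.IsBounded K ∧ ∀ ω t, G ω t ⊆ K)
    (hpred : IsMeasurableSetMap (predictableSigmaAlgebra X 𝓕 P)
      (fun p : Ω × Icc t₀ T => G p.1 p.2))
    (a b : Icc t₀ T) :
    (∀ ω, (aumannIntervalIntegral (G ω) a b).Nonempty) ∧
    IsMeasurableSetMap m (fun ω => aumannIntervalIntegral (G ω) a b) ∧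
    IsRandomClosedSet m (fun ω => aumannIntervalIntegral (G ω) a b) ∧
    (∀ ω, Bornology.IsBounded (aumannIntervalIntegral (G ω) a b)) ∧
    (∀ ω, Convex ℝ (aumannIntervalIntegral (G ω) a b)) := by
  have : SeparableSpace X := separableSpace_of_separableSpace_dual
  obtain ⟨K, hK, hGK⟩ := hbounded
  obtain ⟨R, hKR⟩ := hK.exists_norm_le
  have hR : ∀ ω t, ∀ x ∈ G ω t, ‖x‖ ≤ R := fun ω t x hx => hKR x (hGK ω t hx)
  let I (A : Set (Icc t₀ T)) (ω : Ω) : Set X := aumannIntegral (lebesgueIcc t₀ T) (G ω) A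
  have hrandom (A) : IsRandomClosedSet m (I A) :=
    ⟨fun ω => ⟨0, zero_mem_aumannIntegral _ (hzero ω) A⟩,
      fun ω => hrefl.isClosed_aumannIntegral (hclosed ω) (hconvex ω) (hR ω) A,
      isMeasurableSetMap_aumannIntegral_of_predictable hpred hclosed hzero hconvex hR A⟩
  have hbdd (A ω) : Bornology.IsBounded (I A ω) :=
    isBounded_iff_forall_norm_le.2 ⟨_, fun _ => norm_le_of_mem_aumannIntegral (hR ω)⟩
  have hconv (A ω) : Convex ℝ (I A ω) := convex_aumannIntegral _ (hconvex ω) A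
  unfold aumannIntervalIntegral
  split_ifs
  · exact ⟨(hrandom _).nonempty, (hrandom _).measurable, hrandom _, hbdd _, hconv _⟩
  · exact ⟨(hrandom _).neg.nonempty, (hrandom _).neg.measurable, (hrandom _).neg,
      fun ω => (hbdd _ ω).neg, fun ω => (hconv _ ω).neg⟩

theorem mainTheorem3
    {X : Type*} [NormedAddCommGroup X] [NormedSpace ℝ X] [CompleteSpace X]
    (hrefl : IsReflexiveSpace X) (hsep : TopologicalSpace.SeparableSpace (StrongDual ℝ X))
    {t₀ T : ℝ}
    {Ω : Type*} {m : MeasurableSpace Ω} (P : Measure Ω) [IsProbabilityMeasure P]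
    (𝓕 : Filtration (Icc t₀ T) m) (h𝓕 : HasUsualConditions 𝓕 P)
    (G : Ω → Icc t₀ T → Set X)
    (hclosed : ∀ ω t, IsClosed (G ω t))
    (hzero : ∀ ω t, (0 : X) ∈ G ω t)
    (hconvex : ∀ ω t, Convex ℝ (G ω t))
    (hbounded : ∃ K : Set X, K.Nonempty ∧ IsClosed K ∧ Bornology.IsBounded K ∧
      ∀ ω t, G ω t ⊆ K)
    (hpred : IsMeasurableSetMap (predictableSigmaAlgebra X 𝓕 P)
      (fun p : Ω × Icc t₀ T => G p.1 p.2))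
    (a b : Icc t₀ T) :
    (∀ ω, (aumannIntervalIntegral (G ω) a b).Nonempty) ∧
    IsMeasurableSetMap m (fun ω => aumannIntervalIntegral (G ω) a b) ∧
    IsRandomClosedSet m (fun ω => aumannIntervalIntegral (G ω) a b) ∧
    (∀ ω, Bornology.IsBounded (aumannIntervalIntegral (G ω) a b)) ∧
    (∀ ω, Convex ℝ (aumannIntervalIntegral (G ω) a b)) := by
  have : P.IsComplete := ⟨fun s hs => 𝓕.le a s (h𝓕.null_mem a s hs)⟩
  obtain ⟨K, -, -, hK, hGK⟩ := hbounded
  exact mainTheorem3_general hrefl P 𝓕 G hclosed hzero hconvex ⟨K, hK, hGK⟩ hpred a b
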